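/- Let $d\ge 1$ and $0\le s\le\lfloor d/2\rfloor$ be integers. A real polynomial of degree $d$ has signature $s$ if it has exactly $s$ pairs of complex conjugate non-real roots, counted with multiplicity. For real $B\ge 1$ let $D_d(s,B)$ be the number of polynomials $p_dX^d+\dots+p_0\in\mathbb Z[X]$ with $p_d\ne 0$, $|p_i|\le B$ for $0\le i\le d$, and signature $s$. Let $\mathcal H_d(s)$ be the set of vectors $(p_0,\dots,p_d)\in[-1,1]^{d+1}$ with $p_d\neq 0$ such that the polynomial $p_dX^d+\dots+p_0$ has signature $s$. Then $\mathcal H_d(s)$ is Lebesgue measurable, and, with $\lambda_{d+1}$ the Lebesgue measure on $\mathbb R^{d+1}$, $$D_d(s,B)=\lambda_{d+1}(\mathcal H_d(s))\,B^{d+1}+O(B^d)\qquad (B\ge 1),$$ where the implied constant depends only on $d$ and $s$. Moreover, $\lambda_{d+1}(\mathcal H_d(s))>0$ for all such $d$ and $s$. -/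

import Mathlib

namespace PolySignature

open Polynomial

noncomputable section

/-- The real polynomial `p_d X^d + ... + p_1 X + p_0` with coefficient vector `p`. -/
def toPoly {d : ℕ} (p : Fin (d + 1) → ℝ) : ℝ[X] :=
  ∑ i : Fin (d + 1), C (p i) * X ^ (i : ℕ)

/-- `P` has signature `s`: it has exactly `s` pairs of complex conjugate non-real roots,
i.e. exactly `2 * s` non-real complex roots, counted with multiplicity. -/
def HasSignature (P : ℝ[X]) (s : ℕ) : Prop :=
  (P.aroots ℂ).countP (fun z : ℂ => z.im ≠ 0) = 2 * s

/-- The set of real coefficient vectors `(p_0, ..., p_d)` with `p_d ≠ 0` and `|p_i| ≤ B`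
whose polynomial (of degree `d`) has signature `s`. -/
def coeffSet (d s : ℕ) (B : ℝ) : Set (Fin (d + 1) → ℝ) :=
  {p | p (Fin.last d) ≠ 0 ∧ (∀ i, |p i| ≤ B) ∧ HasSignature (toPoly p) s}

/-- The set of integer polynomials of degree exactly `d`, all of whose coefficients have
absolute value at most `B`, with signature `s`. -/
def intPolySet (d s : ℕ) (B : ℝ) : Set ℤ[X] :=
  {f | f.degree = (d : WithBot ℕ) ∧ (∀ i ≤ d, |(f.coeff i : ℝ)| ≤ B) ∧
    HasSignature (f.map (Int.castRingHom ℝ)) s}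

/-- The number of integer polynomials of degree `d` and signature `s` whose coefficients
are bounded in absolute value by `B`. -/
def intPolyCount (d s : ℕ) (B : ℝ) : ℕ :=
  (intPolySet d s B).ncard

end

end PolySignature

/-! The signature condition scales: `coeffSet d s B` is the `B`-dilate of `coeffSet d s 1`, so its
volume is the main term and the count is a lattice point problem. The error is controlled by a
Davenport-type argument (`abs_ncard_sub_volume_le`): if membership along every axis-parallel line
changes at no more than a fixed number of points, then rounding one coordinate at a time changes the
volume by `O(B^d)` per coordinate.

The line condition is `exists_finset_coeffSet_update`. Complex roots vary continuously, and non-real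
ones come in conjugate pairs, so the number of non-real roots can change only where a real root
becomes multiple or the degree drops. On a line in direction `X ^ i`, nonzero multiple roots are
zeros of the fixed polynomial `X * P' - i * P`, leaving at most `d` critical parameters. The root
`0` needs separate care, because it may be multiple along a whole line; its multiplicity is constant
there away from the parameter `0`.

Root continuity also gives measurability, through semicontinuity of the count, and positivity,
through a neighbourhood of a model polynomial whose real roots are simple. -/

namespace PolySignature

open Polynomial Filter Topology

variable {d : ℕ}

/-! ### Continuity of roots and measurability. -/

theorem coeff_toPoly (p : Fin (d + 1) → ℝ) (n : ℕ) :
    (toPoly p).coeff n = if h : n < d + 1 then p ⟨n, h⟩ else 0 := by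
  simp only [toPoly, finsetSum_coeff, coeff_C_mul, coeff_X_pow]
  split_ifs with h
  · rw [Finset.sum_eq_single ⟨n, h⟩]
    · simp
    · intro b _ hb
      rw [if_neg, mul_zero]
      rintro rfl
      exact hb rfl
    · simp
  · refine Finset.sum_eq_zero fun i _ => ?_
    rw [if_neg, mul_zero]
    have := i.2
    omega

@[simp]
theorem coeff_toPoly_fin (p : Fin (d + 1) → ℝ) (i : Fin (d + 1)) :
    (toPoly p).coeff i = p i := by
  rw [coeff_toPoly, dif_pos i.2]

theorem natDegree_toPoly_le (p : Fin (d + 1) → ℝ) : (toPoly p).natDegree ≤ d := by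
  rw [natDegree_le_iff_coeff_eq_zero]
  intro n hn
  rw [coeff_toPoly, dif_neg (by omega)]

theorem natDegree_toPoly {p : Fin (d + 1) → ℝ} (hp : p (Fin.last d) ≠ 0) :
    (toPoly p).natDegree = d := by
  refine le_antisymm (natDegree_toPoly_le p) (le_natDegree_of_ne_zero ?_)
  simpa using (coeff_toPoly_fin p (Fin.last d)).trans_ne hp

theorem leadingCoeff_toPoly {p : Fin (d + 1) → ℝ} (hp : p (Fin.last d) ≠ 0) :
    (toPoly p).leadingCoeff = p (Fin.last d) := by
  rw [leadingCoeff, natDegree_toPoly hp]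
  exact coeff_toPoly_fin p (Fin.last d)

theorem toPoly_ne_zero {p : Fin (d + 1) → ℝ} (hp : p (Fin.last d) ≠ 0) : toPoly p ≠ 0 := by
  rw [← leadingCoeff_ne_zero, leadingCoeff_toPoly hp]
  exact hp

theorem aeval_toPoly (p : Fin (d + 1) → ℝ) (x : ℂ) :
    aeval x (toPoly p) = ∑ i, (p i : ℂ) * x ^ (i : ℕ) := by
  simp [toPoly]

theorem toPoly_coeff {P : ℝ[X]} (hP : P.natDegree ≤ d) :
    toPoly (fun i : Fin (d + 1) => P.coeff i) = P := by
  ext n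
  rw [coeff_toPoly]
  split_ifs with h
  · rfl
  · exact (coeff_eq_zero_of_natDegree_lt (by omega)).symm

/-- The number of non-real complex roots, counted with multiplicity. -/
noncomputable def nonrealCount (P : ℝ[X]) : ℕ :=
  (P.aroots ℂ).countP (fun z : ℂ => z.im ≠ 0)

/-- `z` enumerates, for each coefficient vector of exact degree `d`, the complex roots. -/
def IsRootLabelling (z : (Fin (d + 1) → ℝ) → Fin d → ℂ) : Prop :=
  ∀ p, p (Fin.last d) ≠ 0 → Finset.univ.val.map (z p) = (toPoly p).aroots ℂ

/-- The ordering of the roots is arbitrary, with no continuity in `p`; limits along ultrafilters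
make up for this. -/
theorem exists_isRootLabelling (d : ℕ) :
    ∃ z : (Fin (d + 1) → ℝ) → Fin d → ℂ, IsRootLabelling z := by
  have key : ∀ p : Fin (d + 1) → ℝ, ∃ f : Fin d → ℂ, p (Fin.last d) ≠ 0 →
      Finset.univ.val.map f = (toPoly p).aroots ℂ := by
    intro p
    by_cases hp : p (Fin.last d) = 0
    · exact ⟨0, fun h => absurd hp h⟩
    have hc : ((toPoly p).aroots ℂ).card = d := by
      rw [IsAlgClosed.card_aroots_eq_natDegree, natDegree_toPoly hp]
    obtain ⟨l, hl⟩ := Quot.exists_rep ((toPoly p).aroots ℂ)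
    change (l : Multiset ℂ) = _ at hl
    rw [← hl, Multiset.coe_card] at hc
    subst hc
    refine ⟨l.get, fun _ => ?_⟩
    rw [Fin.univ_val_map, List.ofFn_get, hl]
  choose z hz using key
  exact ⟨z, hz⟩

theorem IsRootLabelling.exists_eq_iff {z : (Fin (d + 1) → ℝ) → Fin d → ℂ} (hz : IsRootLabelling z)
    {p : Fin (d + 1) → ℝ} (hp : p (Fin.last d) ≠ 0) {x : ℂ} :
    (∃ j, z p j = x) ↔ aeval x (toPoly p) = 0 := by
  have : x ∈ (toPoly p).aroots ℂ ↔ aeval x (toPoly p) = 0 := by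
    rw [mem_aroots]
    exact and_iff_right (toPoly_ne_zero hp)
  rw [← this, ← hz p hp]
  simp

theorem IsRootLabelling.aeval_eq {z : (Fin (d + 1) → ℝ) → Fin d → ℂ} (hz : IsRootLabelling z)
    {p : Fin (d + 1) → ℝ} (hp : p (Fin.last d) ≠ 0) (x : ℂ) :
    aeval x (toPoly p) = p (Fin.last d) * ∏ j, (x - z p j) := by
  have h := (IsAlgClosed.splits ((toPoly p).map (algebraMap ℝ ℂ))).eq_prod_roots
  rw [← aroots_def, ← hz p hp, leadingCoeff_map, leadingCoeff_toPoly hp, Multiset.map_map] at h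
  change _ = _ * ∏ j, (X - C (z p j)) at h
  rw [← eval_map_algebraMap, h, eval_mul, eval_prod]
  simp

theorem norm_lt_of_aeval_eq_zero {p : Fin (d + 1) → ℝ} (hp : p (Fin.last d) ≠ 0) {x : ℂ}
    (hx : aeval x (toPoly p) = 0) : ‖x‖ < ‖p‖ / |p (Fin.last d)| + 1 := by
  have hinj := (algebraMap ℝ ℂ).injective
  have h0 : (toPoly p).map (algebraMap ℝ ℂ) ≠ 0 := (Polynomial.map_ne_zero_iff hinj).2 (toPoly_ne_zero hp)
  have h1 : ((toPoly p).map (algebraMap ℝ ℂ)).IsRoot x := by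
    rw [IsRoot, eval_map_algebraMap, hx]
  have h2 : ‖x‖ < (((toPoly p).map (algebraMap ℝ ℂ)).cauchyBound : ℝ) :=
    NNReal.coe_lt_coe.2 (h1.norm_lt_cauchyBound h0)
  refine h2.trans_le ?_
  have h3 : (Finset.range ((toPoly p).map (algebraMap ℝ ℂ)).natDegree).sup
      (fun n => ‖((toPoly p).map (algebraMap ℝ ℂ)).coeff n‖₊) ≤ ‖p‖₊ := by
    refine Finset.sup_le fun n _ => ?_
    rw [coeff_map, coeff_toPoly]
    split_ifs with h
    · have := nnnorm_le_pi_nnnorm p ⟨n, h⟩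
      simpa using this
    · simp
  rw [cauchyBound, leadingCoeff_map, leadingCoeff_toPoly hp, NNReal.coe_add, NNReal.coe_div]
  have h4 : ((‖(algebraMap ℝ ℂ) (p (Fin.last d))‖₊ : NNReal) : ℝ) = |p (Fin.last d)| := by simp
  rw [h4]
  have h5 := NNReal.coe_le_coe.2 h3
  rw [coe_nnnorm] at h5
  gcongr
  simp

/-- Continuity of roots by compactness: the Cauchy bound confines the roots to a fixed ball near
`q`, so each labelled root converges along `U`. Passing to the limit in the factorisation identifies
the limits as the roots of `toPoly q` with multiplicity. -/
theorem IsRootLabelling.exists_tendsto {z : (Fin (d + 1) → ℝ) → Fin d → ℂ}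
    (hz : IsRootLabelling z) {q : Fin (d + 1) → ℝ} (hq : q (Fin.last d) ≠ 0)
    (U : Ultrafilter (Fin (d + 1) → ℝ)) (hU : (U : Filter (Fin (d + 1) → ℝ)) ≤ 𝓝 q) :
    ∃ w : Fin d → ℂ, Finset.univ.val.map w = (toPoly q).aroots ℂ ∧
      ∀ j, Tendsto (fun p => z p j) U (𝓝 (w j)) := by
  have hlast : Tendsto (fun p : Fin (d + 1) → ℝ => p (Fin.last d)) U (𝓝 (q (Fin.last d))) :=
    ((continuous_apply (Fin.last d)).tendsto q).mono_left hU
  have hne : ∀ᶠ p in (U : Filter (Fin (d + 1) → ℝ)), p (Fin.last d) ≠ 0 := hlast.eventually_ne hq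
  have hbd : Tendsto (fun p : Fin (d + 1) → ℝ => ‖p‖ / |p (Fin.last d)| + 1) U
      (𝓝 (‖q‖ / |q (Fin.last d)| + 1)) :=
    (((continuous_norm.tendsto q).mono_left hU).div hlast.abs (abs_ne_zero.2 hq)).add_const 1
  have hlim : ∀ j, ∃ w, Tendsto (fun p => z p j) U (𝓝 w) := by
    intro j
    have hev : ∀ᶠ p in (U : Filter (Fin (d + 1) → ℝ)),
        z p j ∈ Metric.closedBall (0 : ℂ) (‖q‖ / |q (Fin.last d)| + 1 + 1) := by
      filter_upwards [hne, hbd.eventually_lt_const (lt_add_one _)] with p hp hlt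
      have := norm_lt_of_aeval_eq_zero hp ((hz.exists_eq_iff hp).1 ⟨j, rfl⟩)
      rw [mem_closedBall_zero_iff]
      exact (this.trans hlt).le
    obtain ⟨w, -, hw⟩ := (isCompact_closedBall (0 : ℂ) _).ultrafilter_le_nhds'
      (U.map fun p => z p j) hev
    exact ⟨w, hw⟩
  choose w hw using hlim
  refine ⟨w, ?_, hw⟩
  have heq : ∀ x : ℂ, aeval x (toPoly q) = q (Fin.last d) * ∏ j, (x - w j) := by
    intro x
    have hr : Tendsto (fun p : Fin (d + 1) → ℝ => (p (Fin.last d) : ℂ) * ∏ j, (x - z p j)) U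
        (𝓝 (q (Fin.last d) * ∏ j, (x - w j))) :=
      ((Complex.continuous_ofReal.tendsto _).comp hlast).mul
        (tendsto_finsetProd _ fun j _ => tendsto_const_nhds.sub (hw j))
    have hl : Tendsto (fun p : Fin (d + 1) → ℝ => aeval x (toPoly p)) U
        (𝓝 (aeval x (toPoly q))) := by
      simp only [aeval_toPoly]
      have : Continuous fun p : Fin (d + 1) → ℝ => ∑ i, (p i : ℂ) * x ^ (i : ℕ) := by fun_prop
      exact (this.tendsto q).mono_left hU
    refine tendsto_nhds_unique hl (hr.congr' ?_)
    filter_upwards [hne] with p hp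
    rw [hz.aeval_eq hp]
  have hpoly : (toPoly q).map (algebraMap ℝ ℂ) =
      C (q (Fin.last d) : ℂ) * (Finset.univ.val.map fun j => X - C (w j)).prod := by
    refine Polynomial.funext fun x => ?_
    change _ = eval x (_ * ∏ j, (X - C (w j)))
    rw [eval_map_algebraMap, heq, eval_mul, eval_prod]
    simp
  have hmap : (Finset.univ.val.map fun j => X - C (w j)) =
      (Finset.univ.val.map w).map fun a => X - C a := by
    rw [Multiset.map_map]
    rfl
  rw [aroots_def, hpoly, hmap, roots_C_mul _ (by exact_mod_cast hq), roots_multiset_prod_X_sub_C]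

theorem nonrealCount_eq_card {P : ℝ[X]} {w : Fin d → ℂ}
    (hw : Finset.univ.val.map w = P.aroots ℂ) :
    nonrealCount P = (Finset.univ.filter fun j => (w j).im ≠ 0).card := by
  rw [nonrealCount, ← hw, Multiset.countP_map]
  rfl

theorem count_aroots_eq_card {P : ℝ[X]} {w : Fin d → ℂ}
    (hw : Finset.univ.val.map w = P.aroots ℂ) (x : ℂ) :
    (P.aroots ℂ).count x = (Finset.univ.filter fun j => x = w j).card := by
  rw [← hw, Multiset.count_map]
  rfl

/-- Lower semicontinuity: being non-real is an open condition, so a root with non-real limit is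
itself eventually non-real. -/
theorem eventually_nonrealCount_le {q : Fin (d + 1) → ℝ} (hq : q (Fin.last d) ≠ 0) :
    ∀ᶠ p in 𝓝 q, nonrealCount (toPoly q) ≤ nonrealCount (toPoly p) := by
  obtain ⟨z, hz⟩ := exists_isRootLabelling d
  refine mem_iff_ultrafilter.2 fun U hU => ?_
  obtain ⟨w, hw, hlim⟩ := hz.exists_tendsto hq U hU
  have hne : ∀ᶠ p in (U : Filter (Fin (d + 1) → ℝ)), p (Fin.last d) ≠ 0 :=
    (((continuous_apply (Fin.last d)).tendsto q).mono_left hU).eventually_ne hq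
  have him : ∀ᶠ p in (U : Filter (Fin (d + 1) → ℝ)), ∀ j, (w j).im ≠ 0 → (z p j).im ≠ 0 := by
    rw [eventually_all]
    intro j
    by_cases hj : (w j).im = 0
    · simp [hj]
    · filter_upwards [((Complex.continuous_im.tendsto _).comp (hlim j)).eventually_ne hj] with p hp _
      exact hp
  filter_upwards [hne, him] with p hp hi
  rw [nonrealCount_eq_card hw, nonrealCount_eq_card (hz p hp)]
  exact Finset.card_le_card (Finset.monotone_filter_right _ fun j _ => hi j)

theorem count_aroots_le_one {P : ℝ[X]} (hP : P ≠ 0) {x : ℝ}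
    (h : P.eval x = 0 → P.derivative.eval x ≠ 0) : (P.aroots ℂ).count (x : ℂ) ≤ 1 := by
  by_contra! hlt
  have hinj := (algebraMap ℝ ℂ).injective
  have h0 : P.map (algebraMap ℝ ℂ) ≠ 0 := (Polynomial.map_ne_zero_iff hinj).2 hP
  rw [aroots_def, count_roots, one_lt_rootMultiplicity_iff_isRoot h0, derivative_map] at hlt
  have key : ∀ Q : ℝ[X], (Q.map (algebraMap ℝ ℂ)).IsRoot (x : ℂ) → Q.eval x = 0 := by
    intro Q hQ
    exact (isRoot_map_iff (x := x) hinj).1 hQ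
  exact h (key _ hlt.1) (key _ hlt.2)

/-- If all nonzero real roots of `toPoly q` are simple, the number of non-real roots is locally
constant at `q` among vectors for which the multiplicity of the root `0` does not change. -/
theorem eventually_nonrealCount_eq {q : Fin (d + 1) → ℝ} (hq : q (Fin.last d) ≠ 0)
    {S : Set (Fin (d + 1) → ℝ)}
    (hS : ∀ p ∈ S, (toPoly p).rootMultiplicity 0 = (toPoly q).rootMultiplicity 0)
    (hsimple : ∀ x : ℝ, x ≠ 0 → (toPoly q).eval x = 0 → (toPoly q).derivative.eval x ≠ 0) :
    ∀ᶠ p in 𝓝[S] q, nonrealCount (toPoly p) = nonrealCount (toPoly q) := by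
  obtain ⟨z, hz⟩ := exists_isRootLabelling d
  refine mem_iff_ultrafilter.2 fun U hUS => ?_
  have hU := hUS.trans nhdsWithin_le_nhds
  have hUS' : ∀ᶠ p in (U : Filter (Fin (d + 1) → ℝ)), p ∈ S := hUS self_mem_nhdsWithin
  obtain ⟨w, hw, hlim⟩ := hz.exists_tendsto hq U hU
  have hne : ∀ᶠ p in (U : Filter (Fin (d + 1) → ℝ)), p (Fin.last d) ≠ 0 :=
    (((continuous_apply (Fin.last d)).tendsto q).mono_left hU).eventually_ne hq
  -- Labels with `z p j = 0` are eventually among those with `w j = 0`; equal multiplicity of the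
  -- root `0` makes the two sets coincide.
  have hzero : ∀ᶠ p in (U : Filter (Fin (d + 1) → ℝ)), ∀ j, w j = 0 → z p j = 0 := by
    have h1 : ∀ᶠ p in (U : Filter (Fin (d + 1) → ℝ)), ∀ j, 0 = z p j → 0 = w j := by
      rw [eventually_all]
      intro j
      by_cases hj : w j = 0
      · simp [hj]
      · filter_upwards [(hlim j).eventually_ne hj] with p hp h
        exact absurd h.symm hp
    filter_upwards [hne, h1, hUS'] with p hp h hpS
    have hmult : ∀ r : Fin (d + 1) → ℝ,
        ((toPoly r).aroots ℂ).count 0 = (toPoly r).rootMultiplicity 0 := by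
      intro r
      rw [aroots_def, count_roots, eq_rootMultiplicity_map (algebraMap ℝ ℂ).injective, map_zero]
    have hcard : (Finset.univ.filter fun j => 0 = w j).card ≤
        (Finset.univ.filter fun j => 0 = z p j).card := by
      rw [← count_aroots_eq_card hw, ← count_aroots_eq_card (hz p hp), hmult, hmult, hS p hpS]
    have heq := Finset.eq_of_subset_of_card_le (Finset.monotone_filter_right _ fun j _ => h j) hcard
    intro j hj
    have : j ∈ Finset.univ.filter fun j => 0 = z p j := by
      rw [heq]
      simp [hj]
    simpa [eq_comm] using this
  have him : ∀ᶠ p in (U : Filter (Fin (d + 1) → ℝ)), ∀ j, (z p j).im ≠ 0 ↔ (w j).im ≠ 0 := by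
    rw [eventually_all]
    intro j
    by_cases hj : (w j).im = 0
    · by_cases hj0 : w j = 0
      · filter_upwards [hzero] with p hp
        simp [hp j hj0, hj0]
      -- If a non-real root tended to a nonzero real limit, its conjugate, carrying another label,
      -- would tend to the same limit, which would then be a multiple root.
      by_contra hcon
      rw [← Ultrafilter.eventually_not] at hcon
      have hconj : ∀ᶠ p in (U : Filter (Fin (d + 1) → ℝ)), ∃ k, k ≠ j ∧
          z p k = (starRingEnd ℂ) (z p j) := by
        filter_upwards [hcon, hne] with p hp hp0
        have hpj : (z p j).im ≠ 0 := by
          intro h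
          exact hp (by simp [h, hj])
        have hroot : aeval ((starRingEnd ℂ) (z p j)) (toPoly p) = 0 := by
          rw [aeval_conj, (hz.exists_eq_iff hp0).1 ⟨j, rfl⟩, map_zero]
        obtain ⟨k, hk⟩ := (hz.exists_eq_iff hp0).2 hroot
        refine ⟨k, ?_, hk⟩
        rintro rfl
        exact hpj (Complex.conj_eq_iff_im.1 hk.symm)
      -- The label of the conjugate depends on `p`, but there are finitely many labels, so the
      -- ultrafilter selects one.
      obtain ⟨k, hk⟩ := Ultrafilter.eventually_exists_iff.1 hconj
      obtain ⟨p, hkj, -⟩ := hk.exists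
      have hwk : w k = w j := by
        have h1 : Tendsto (fun p => z p k) U (𝓝 ((starRingEnd ℂ) (w j))) := by
          refine ((Complex.continuous_conj.tendsto _).comp (hlim j)).congr' ?_
          filter_upwards [hk] with p hp
          exact hp.2.symm
        rw [tendsto_nhds_unique (hlim k) h1, Complex.conj_eq_iff_im.2 hj]
      have hre : ((w j).re : ℂ) = w j := Complex.ext rfl hj.symm
      have hre0 : (w j).re ≠ 0 := by
        intro h
        rw [h] at hre
        exact hj0 hre.symm
      have hle := count_aroots_le_one (toPoly_ne_zero hq) (hsimple _ hre0)
      rw [hre, count_aroots_eq_card hw] at hle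
      exact hkj (Finset.card_le_one.1 hle k (by simp [hwk]) j (by simp))
    · filter_upwards [((Complex.continuous_im.tendsto _).comp (hlim j)).eventually_ne hj] with p hp
      exact iff_of_true hp hj
  filter_upwards [hne, him] with p hp hi
  rw [nonrealCount_eq_card hw, nonrealCount_eq_card (hz p hp)]
  simp only [hi]

/-- By semicontinuity the superlevel sets of the count are open, and a level set is a difference of
two of them. -/
theorem measurableSet_coeffSet (d s : ℕ) (B : ℝ) : MeasurableSet (coeffSet d s B) := by
  have hopen : ∀ k : ℕ, IsOpen {p : Fin (d + 1) → ℝ | p (Fin.last d) ≠ 0 ∧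
      k ≤ nonrealCount (toPoly p)} := by
    intro k
    rw [isOpen_iff_mem_nhds]
    rintro q ⟨hq, hk⟩
    filter_upwards [eventually_nonrealCount_le hq,
      (continuous_apply (Fin.last d)).continuousAt.eventually_ne hq] with p hle hp
    exact ⟨hp, hk.trans hle⟩
  have hbox : MeasurableSet {p : Fin (d + 1) → ℝ | ∀ i, |p i| ≤ B} := by
    simp only [Set.ofPred_forall]
    exact MeasurableSet.iInter fun i => measurableSet_le (by fun_prop) (by fun_prop)
  have heq : coeffSet d s B = ({p : Fin (d + 1) → ℝ | p (Fin.last d) ≠ 0 ∧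
      2 * s ≤ nonrealCount (toPoly p)} \ {p : Fin (d + 1) → ℝ | p (Fin.last d) ≠ 0 ∧
      2 * s + 1 ≤ nonrealCount (toPoly p)}) ∩ {p : Fin (d + 1) → ℝ | ∀ i, |p i| ≤ B} := by
    ext p
    change (_ ∧ _ ∧ nonrealCount (toPoly p) = 2 * s) ↔ _
    simp only [Set.mem_inter_iff, Set.mem_sdiff, Set.mem_ofPred_eq]
    constructor
    · rintro ⟨h1, h2, h3⟩
      exact ⟨⟨⟨h1, h3.ge⟩, fun h => by omega⟩, h2⟩
    · rintro ⟨⟨⟨h1, h3⟩, h4⟩, h2⟩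
      exact ⟨h1, h2, le_antisymm (Nat.le_of_lt_succ (not_le.1 fun h => h4 ⟨h1, h⟩)) h3⟩
  rw [heq]
  exact ((hopen _).measurableSet.diff (hopen _).measurableSet).inter hbox

end PolySignature

/-! ### Critical parameters on axis-parallel lines. -/

namespace PolySignature

open Polynomial Filter Topology

variable {d : ℕ}

theorem toPoly_update (p : Fin (d + 1) → ℝ) (i : Fin (d + 1)) (t : ℝ) :
    toPoly (Function.update p i t) =
      toPoly (Function.update p i 0) + C t * X ^ (i : ℕ) := by
  ext n
  rw [coeff_add, coeff_C_mul, coeff_X_pow, coeff_toPoly, coeff_toPoly]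
  split_ifs with h1 h2 h2
  · have : (⟨n, h1⟩ : Fin (d + 1)) = i := Fin.ext h2
    simp [this]
  · have : (⟨n, h1⟩ : Fin (d + 1)) ≠ i := fun h => h2 (congrArg Fin.val h)
    simp [this]
  · exact absurd i.2 (h2 ▸ h1)
  · simp

theorem rootMultiplicity_zero_eq_of_coeff {P Q : ℝ[X]} (h : ∀ n, P.coeff n = 0 ↔ Q.coeff n = 0) :
    P.rootMultiplicity 0 = Q.rootMultiplicity 0 := by
  have hs : P.support = Q.support := by
    ext n
    simp [h n]
  rw [rootMultiplicity_eq_natTrailingDegree', rootMultiplicity_eq_natTrailingDegree',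
    natTrailingDegree, natTrailingDegree, trailingDegree, trailingDegree, hs]

/-- The operator multiplies the `n`-th coefficient by `n - i`, so it kills only multiples of `X ^
i`. -/
theorem X_mul_derivative_sub_ne_zero {P : ℝ[X]} (hP : P ≠ 0) {i : ℕ} (hi : P.coeff i = 0) :
    X * derivative P - C (i : ℝ) * P ≠ 0 := by
  obtain ⟨n, hn⟩ : ∃ n, P.coeff n ≠ 0 := by
    by_contra! h
    exact hP (by ext n; simp [h n])
  have hc : (X * derivative P - C (i : ℝ) * P).coeff n = ((n : ℝ) - i) * P.coeff n := by
    rw [coeff_sub, coeff_C_mul]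
    cases n with
    | zero => simp
    | succ m =>
      rw [coeff_X_mul, coeff_derivative]
      push_cast
      ring
  intro h
  rw [h, coeff_zero, eq_comm, mul_eq_zero, sub_eq_zero, Nat.cast_inj] at hc
  rcases hc with hc | hc
  · exact hn (hc ▸ hi)
  · exact hn hc

theorem natDegree_X_mul_derivative_sub_le {P : ℝ[X]} (hP : P.natDegree ≤ d) (i : ℕ) :
    (X * derivative P - C (i : ℝ) * P).natDegree ≤ d := by
  refine (natDegree_sub_le _ _).trans (max_le ?_ ((natDegree_C_mul_le _ _).trans hP))
  rw [natDegree_le_iff_coeff_eq_zero]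
  intro n hn
  cases n with
  | zero => omega
  | succ m =>
    rw [coeff_X_mul, coeff_derivative, coeff_eq_zero_of_natDegree_lt (by omega), zero_mul]

/-- On a line in direction `X ^ i`, a parameter whose polynomial has a nonzero double real root
is determined by a root of `X * P' - i * P`. -/
theorem exists_root_of_eval_derivative_eq_zero {P : ℝ[X]} {i : ℕ} (hi : P.coeff i = 0) {t x : ℝ}
    (ht : t ≠ 0) (hx : x ≠ 0) (h : (P + C t * X ^ i).eval x = 0)
    (h' : (P + C t * X ^ i).derivative.eval x = 0) :
    x ∈ (X * derivative P - C (i : ℝ) * P).roots ∧ t = -P.eval x / x ^ i := by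
  have hxi : x ^ i ≠ 0 := pow_ne_zero _ hx
  have hP : P ≠ 0 := by
    rintro rfl
    simp [ht, hx] at h
  rw [eval_add, eval_mul, eval_C, eval_pow, eval_X] at h
  refine ⟨?_, by field_simp; linarith⟩
  rw [mem_roots (X_mul_derivative_sub_ne_zero hP hi), IsRoot]
  -- The factor `x` avoids the exponent `i - 1`; eliminating `t * x ^ i` with `h` then leaves an
  -- equation free of `t`.
  have hd : (P + C t * X ^ i).derivative.eval x * x = P.derivative.eval x * x + t * i * x ^ i := by
    cases i with
    | zero => simp
    | succ m => simp; ring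
  rw [h', zero_mul] at hd
  simp only [eval_sub, eval_mul, eval_X, eval_C]
  linear_combination -hd - (i : ℝ) * h

/-- A locally constant function on an interval is constant. Excluding `t = 0` fixes the support of
the polynomial, hence the multiplicity of the root `0`. -/
theorem nonrealCount_update_eq {p : Fin (d + 1) → ℝ} {i : Fin (d + 1)} {a b : ℝ} (hab : a ≤ b)
    (hlast : ∀ t ∈ Set.Icc a b, Function.update p i t (Fin.last d) ≠ 0)
    (h0 : ∀ t ∈ Set.Icc a b, t ≠ 0)
    (hcrit : ∀ t ∈ Set.Icc a b, ∀ x ∈ (X * derivative (toPoly (Function.update p i 0)) -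
      C ((i : ℕ) : ℝ) * toPoly (Function.update p i 0)).roots,
      t ≠ -(toPoly (Function.update p i 0)).eval x / x ^ (i : ℕ)) :
    nonrealCount (toPoly (Function.update p i a)) =
      nonrealCount (toPoly (Function.update p i b)) := by
  have hci : (toPoly (Function.update p i 0)).coeff i = 0 := by simp
  have hcont : ContinuousOn (fun t => nonrealCount (toPoly (Function.update p i t)))
      (Set.Icc a b) := by
    intro t ht
    have hS : ∀ q ∈ Function.update p i '' Set.Icc a b, (toPoly q).rootMultiplicity 0 =
        (toPoly (Function.update p i t)).rootMultiplicity 0 := by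
      rintro _ ⟨u, hu, rfl⟩
      refine rootMultiplicity_zero_eq_of_coeff fun n => ?_
      rw [coeff_toPoly, coeff_toPoly]
      split_ifs with hn
      · rcases eq_or_ne (⟨n, hn⟩ : Fin (d + 1)) i with h | h
        · simp [h, h0 u hu, h0 t ht]
        · simp [h]
      · simp
    have hev := eventually_nonrealCount_eq (hlast t ht) hS fun x hx hroot hder => by
      rw [toPoly_update] at hroot hder
      obtain ⟨h1, h2⟩ := exists_root_of_eval_derivative_eq_zero hci (h0 t ht) hx hroot hder
      exact hcrit t ht x h1 h2
    have hupd : Tendsto (Function.update p i) (𝓝[Set.Icc a b] t)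
        (𝓝[Function.update p i '' Set.Icc a b] (Function.update p i t)) := by
      refine ContinuousWithinAt.tendsto_nhdsWithin_image ?_
      exact (continuous_const.update i continuous_id).continuousWithinAt
    exact tendsto_const_nhds.congr' ((hupd.eventually hev).mono fun _ h => h.symm)
  exact isPreconnected_Icc.constant hcont (Set.left_mem_Icc.2 hab) (Set.right_mem_Icc.2 hab)

/-- On every line parallel to a coordinate axis, membership in `coeffSet d s B` is constant on
intervals avoiding a set of at most `d + 3` points. -/
theorem exists_finset_coeffSet_update (s : ℕ) (B : ℝ) (p : Fin (d + 1) → ℝ) (i : Fin (d + 1)) :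
    ∃ F : Finset ℝ, F.card ≤ d + 3 ∧ ∀ a b, a ≤ b → (∀ t ∈ Set.Icc a b, t ∉ F) →
      (Function.update p i a ∈ coeffSet d s B ↔ Function.update p i b ∈ coeffSet d s B) := by
  set P := toPoly (Function.update p i 0) with hP
  set G := X * derivative P - C ((i : ℕ) : ℝ) * P with hG
  -- The point `0` covers a degree drop or a change of multiplicity at the root `0`, `±B` the faces
  -- of the box, and the image the nonzero multiple real roots.
  refine ⟨{0, B, -B} ∪ G.roots.toFinset.image fun x => -P.eval x / x ^ (i : ℕ), ?_, ?_⟩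
  · have h1 : ({0, B, -B} : Finset ℝ).card ≤ 3 := Finset.card_le_three
    have h2 : (G.roots.toFinset.image fun x => -P.eval x / x ^ (i : ℕ)).card ≤ d :=
      Finset.card_image_le.trans <| (Multiset.toFinset_card_le _).trans <| (card_roots' _).trans <|
        natDegree_X_mul_derivative_sub_le (natDegree_toPoly_le _) _
    exact (Finset.card_union_le _ _).trans (by omega)
  · intro a b hab hF
    simp only [Finset.mem_union, Finset.mem_insert, Finset.mem_singleton, Finset.mem_image,
      Multiset.mem_toFinset, not_or, not_exists, not_and] at hF
    have hlast : ∀ t ∈ Set.Icc a b, ∀ u ∈ Set.Icc a b,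
        Function.update p i t (Fin.last d) ≠ 0 → Function.update p i u (Fin.last d) ≠ 0 := by
      intro t _ u hu h
      rcases eq_or_ne (Fin.last d) i with hi | hi
      · simpa [hi] using (hF u hu).1.1
      · simpa [hi] using h
    have ha := Set.left_mem_Icc.2 hab
    have hb := Set.right_mem_Icc.2 hab
    have hbound : |a| ≤ B ↔ |b| ≤ B := by
      have hpB : ¬ (a ≤ B ∧ B ≤ b) := fun h => (hF B h).1.2.1 rfl
      have hnB : ¬ (a ≤ -B ∧ -B ≤ b) := fun h => (hF (-B) h).1.2.2 rfl
      rw [not_and_or, not_le, not_le] at hpB hnB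
      rw [abs_le, abs_le]
      constructor
      · rintro ⟨h1, h2⟩
        exact ⟨by linarith, (hpB.resolve_left h2.not_gt).le⟩
      · rintro ⟨h1, h2⟩
        exact ⟨(hnB.resolve_right h1.not_gt).le, by linarith⟩
    have hbox : (∀ j, |Function.update p i a j| ≤ B) ↔ ∀ j, |Function.update p i b j| ≤ B := by
      refine forall_congr' fun j => ?_
      rcases eq_or_ne j i with hj | hj
      · simpa [hj] using hbound
      · simp [hj]
    change (_ ∧ _ ∧ nonrealCount _ = _) ↔ (_ ∧ _ ∧ nonrealCount _ = _)
    rw [hbox]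
    by_cases h : Function.update p i a (Fin.last d) = 0
    · have h' : Function.update p i b (Fin.last d) = 0 := by
        by_contra hne
        exact hlast b hb a ha hne h
      simp [h, h']
    · rw [nonrealCount_update_eq hab (fun t ht => hlast a ha t ht h) (fun t ht => (hF t ht).1.1)
        fun t ht x hx he => (hF t ht).2 x hx he.symm]
      exact and_congr_left fun _ => iff_of_true h (hlast a ha b hb h)

end PolySignature

/-! ### Lattice points and volume by successive rounding. -/

namespace PolySignature

open MeasureTheory

/-- Membership in `A` along every line parallel to a coordinate axis changes at most at `m`
points. -/
def HasLineBreaks {n : ℕ} (A : Set (Fin n → ℝ)) (m : ℕ) : Prop :=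
  ∀ (p : Fin n → ℝ) (i : Fin n), ∃ F : Finset ℝ, F.card ≤ m ∧
    ∀ a b, a ≤ b → (∀ t ∈ Set.Icc a b, t ∉ F) →
      (Function.update p i a ∈ A ↔ Function.update p i b ∈ A)

/-- Round down the first `k` coordinates. -/
noncomputable def floorFirst {n : ℕ} (k : ℕ) (x : Fin n → ℝ) (i : Fin n) : ℝ :=
  if (i : ℕ) < k then (⌊x i⌋ : ℝ) else x i

theorem measurable_floorFirst {n : ℕ} (k : ℕ) :
    Measurable (floorFirst k : (Fin n → ℝ) → Fin n → ℝ) := by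
  refine measurable_pi_lambda _ fun i => ?_
  unfold floorFirst
  split_ifs
  · exact (measurable_from_top (f := fun z : ℤ => (z : ℝ))).comp
      (Int.measurable_floor.comp (measurable_pi_apply i))
  · exact measurable_pi_apply i

theorem floorFirst_eq_update {n : ℕ} (k : Fin n) (x : Fin n → ℝ) :
    floorFirst (k : ℕ) x = Function.update (floorFirst k x) k (x k) := by
  rw [eq_comm, Function.update_eq_self_iff]
  simp [floorFirst]

theorem floorFirst_succ_eq_update {n : ℕ} (k : Fin n) (x : Fin n → ℝ) :
    floorFirst ((k : ℕ) + 1) x = Function.update (floorFirst k x) k ⌊x k⌋ := by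
  ext i
  rcases eq_or_ne i k with rfl | h
  · simp [floorFirst]
  · have : (i : ℕ) ≠ k := fun h' => h (Fin.ext h')
    rw [Function.update_of_ne h, floorFirst, floorFirst]
    congr 1
    rw [eq_iff_iff]
    omega

theorem abs_le_of_abs_floorFirst_le {n : ℕ} {k : ℕ} {x : Fin n → ℝ} {i : Fin n} {B : ℝ}
    (h : |floorFirst k x i| ≤ B) : |x i| ≤ B + 1 := by
  rw [floorFirst] at h
  split_ifs at h
  · rw [abs_le] at h ⊢
    have h1 := Int.floor_le (x i)
    have h2 := Int.lt_floor_add_one (x i)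
    constructor <;> linarith
  · linarith

theorem volume_setOf_floor_mem_le (F : Finset ℝ) :
    volume {t : ℝ | ∃ f ∈ F, ⌊t⌋ = ⌊f⌋} ≤ F.card := by
  have hsub : {t : ℝ | ∃ f ∈ F, ⌊t⌋ = ⌊f⌋} ⊆ ⋃ f ∈ F, Set.Ico (⌊f⌋ : ℝ) (⌊f⌋ + 1) := by
    rintro t ⟨f, hf, h⟩
    rw [Set.mem_iUnion₂]
    exact ⟨f, hf, Int.floor_eq_iff.1 h⟩
  refine (measure_mono hsub).trans ((measure_biUnion_finset_le _ _).trans ?_)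
  simp

/-- A set in a box whose fibres in direction `k` have measure at most `m` is small. -/
theorem volume_le_of_fibre_le {n : ℕ} (k : Fin (n + 1)) {E : Set (Fin (n + 1) → ℝ)}
    (hE : MeasurableSet E) {R : ℝ} (hR : ∀ x ∈ E, ∀ i, |x i| ≤ R) {m : ℕ}
    (hm : ∀ y : Fin n → ℝ, volume {t : ℝ | k.insertNth t y ∈ E} ≤ m) :
    volume E ≤ m * ENNReal.ofReal (2 * R) ^ n := by
  have hmp := (volume_preserving_piFinSuccAbove (fun _ : Fin (n + 1) => ℝ) k).symm
  rw [← hmp.measure_preimage hE.nullMeasurableSet]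
  have hE' : MeasurableSet ((MeasurableEquiv.piFinSuccAbove (fun _ => ℝ) k).symm ⁻¹' E) :=
    hmp.measurable hE
  change (volume.prod volume) _ ≤ _
  rw [Measure.prod_apply_symm hE']
  have hle : ∀ y : Fin n → ℝ, volume ((fun x : ℝ => (x, y)) ⁻¹'
      ((MeasurableEquiv.piFinSuccAbove (fun _ => ℝ) k).symm ⁻¹' E)) ≤
      (Set.univ.pi fun _ : Fin n => Set.Icc (-R) R).indicator (fun _ => (m : ENNReal)) y := by
    intro y
    by_cases hy : y ∈ Set.univ.pi fun _ : Fin n => Set.Icc (-R) R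
    · rw [Set.indicator_of_mem hy]
      exact hm y
    · rw [Set.indicator_of_notMem hy, nonpos_iff_eq_zero]
      convert measure_empty (μ := (volume : Measure ℝ))
      rw [Set.eq_empty_iff_forall_notMem]
      intro t ht
      refine hy fun j _ => abs_le.1 ?_
      have : k.insertNth t y ∈ E := ht
      simpa using hR _ this (k.succAbove j)
  refine (lintegral_mono hle).trans ?_
  rw [lintegral_indicator_const (MeasurableSet.univ_pi fun _ => measurableSet_Icc),
    volume_pi_pi]
  simp [two_mul]

/-- Only coordinate `k` differs between the two roundings, so on a fibre they disagree at `t` only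
if a break lies in `[⌊t⌋, t]`, that is, only if `t` shares a unit cell with one of at most `m`
breaks. Rounding moves coordinates by less than `1`, whence the box of radius `B + 1`. -/
theorem volume_symmDiff_floorFirst_le {n m : ℕ} {A : Set (Fin (n + 1) → ℝ)} (hA : MeasurableSet A)
    {B : ℝ} (hB : ∀ x ∈ A, ∀ i, |x i| ≤ B) (hm : HasLineBreaks A m) (k : Fin (n + 1)) :
    volume (symmDiff (floorFirst (k : ℕ) ⁻¹' A) (floorFirst ((k : ℕ) + 1) ⁻¹' A)) ≤
      m * ENNReal.ofReal (2 * (B + 1)) ^ n := by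
  refine volume_le_of_fibre_le k ((measurable_floorFirst _ hA).symmDiff
    (measurable_floorFirst _ hA)) ?_ fun y => ?_
  · rintro x (⟨hx, -⟩ | ⟨hx, -⟩) i <;> exact abs_le_of_abs_floorFirst_le (hB _ hx i)
  · obtain ⟨F, hF, h⟩ := hm (floorFirst (k : ℕ) (k.insertNth 0 y)) k
    have hupd : ∀ t u : ℝ, Function.update (floorFirst (k : ℕ) (k.insertNth t y)) k u =
        Function.update (floorFirst (k : ℕ) (k.insertNth 0 y)) k u := by
      intro t u
      ext i
      rcases eq_or_ne i k with rfl | hi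
      · simp
      · obtain ⟨j, rfl⟩ := Fin.exists_succAbove_eq hi
        simp [floorFirst]
    refine (measure_mono ?_).trans ((volume_setOf_floor_mem_le F).trans (by exact_mod_cast hF))
    intro t ht
    by_contra hcon
    have hiff := h ⌊t⌋ t (Int.floor_le t) fun u hu huF => hcon ⟨u, huF, by
      refine le_antisymm (Int.le_floor.2 hu.1) (Int.floor_mono hu.2)⟩
    have ht' : k.insertNth t y ∈ symmDiff (floorFirst (k : ℕ) ⁻¹' A)
      (floorFirst ((k : ℕ) + 1) ⁻¹' A) := ht
    rw [Set.mem_symmDiff, Set.mem_preimage, Set.mem_preimage, floorFirst_succ_eq_update,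
      floorFirst_eq_update, hupd] at ht'
    simp only [Function.update_idem, Fin.insertNth_apply_same] at ht'
    tauto

theorem volume_ne_top_of_abs_le {n : ℕ} {A : Set (Fin n → ℝ)} {R : ℝ}
    (h : ∀ x ∈ A, ∀ i, |x i| ≤ R) : volume A ≠ ⊤ := by
  have hsub : A ⊆ Set.Icc (fun _ => -R) (fun _ => R) := fun x hx =>
    ⟨fun i => (abs_le.1 (h x hx i)).1, fun i => (abs_le.1 (h x hx i)).2⟩
  exact ((measure_mono hsub).trans_lt isCompact_Icc.measure_lt_top).ne

/-- The set is a finite disjoint union of half-open unit cubes, one for each lattice point of `A`.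
-/
theorem volume_floor_preimage_eq_ncard {n : ℕ} {A : Set (Fin n → ℝ)} {B : ℝ}
    (hB : ∀ x ∈ A, ∀ i, |x i| ≤ B) :
    volume.real {x : Fin n → ℝ | (fun i => (⌊x i⌋ : ℝ)) ∈ A} =
      {z : Fin n → ℤ | (fun i => (z i : ℝ)) ∈ A}.ncard := by
  set S := {z : Fin n → ℤ | (fun i => (z i : ℝ)) ∈ A} with hS
  have hfin : S.Finite := by
    refine (Set.finite_Icc (fun _ => -⌊B⌋) (fun _ => ⌊B⌋)).subset fun z hz => ?_
    have hz' : ∀ i, |z i| ≤ ⌊B⌋ := fun i => Int.le_floor.2 (by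
      rw [Int.cast_abs]
      exact hB _ hz i)
    exact ⟨fun i => (abs_le.1 (hz' i)).1, fun i => (abs_le.1 (hz' i)).2⟩
  have heq : {x : Fin n → ℝ | (fun i => (⌊x i⌋ : ℝ)) ∈ A} =
      ⋃ z ∈ hfin.toFinset, Set.univ.pi fun i => Set.Ico (z i : ℝ) (z i + 1) := by
    ext x
    simp only [Set.mem_iUnion₂, Set.Finite.mem_toFinset, Set.mem_univ_pi, exists_prop]
    constructor
    · intro hx
      exact ⟨fun i => ⌊x i⌋, hx, fun i => ⟨Int.floor_le _, Int.lt_floor_add_one _⟩⟩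
    · rintro ⟨z, hz, h⟩
      obtain rfl : z = fun i => ⌊x i⌋ := funext fun i => (Int.floor_eq_iff.2 (h i)).symm
      exact hz
  rw [heq, measureReal_def, measure_biUnion_finset, Set.ncard_eq_toFinset_card _ hfin]
  · simp [Real.volume_pi_Ico]
  · intro z _ w _ hzw
    refine Set.disjoint_left.2 fun x hx hx' => hzw (funext fun i => ?_)
    rw [← Int.floor_eq_iff.2 (hx i trivial), ← Int.floor_eq_iff.2 (hx' i trivial)]
  · exact fun z _ => MeasurableSet.univ_pi fun _ => measurableSet_Ico

/-- A form of Davenport's lattice point estimate. -/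
theorem abs_ncard_sub_volume_le {n m : ℕ} {A : Set (Fin (n + 1) → ℝ)} (hA : MeasurableSet A)
    {B : ℝ} (hB0 : 0 ≤ B) (hB : ∀ x ∈ A, ∀ i, |x i| ≤ B) (hm : HasLineBreaks A m) :
    |({z : Fin (n + 1) → ℤ | (fun i => (z i : ℝ)) ∈ A}.ncard : ℝ) - volume.real A| ≤
      (n + 1) * (m * (2 * (B + 1)) ^ n) := by
  have hfin : ∀ k : ℕ, volume (floorFirst k ⁻¹' A) ≠ ⊤ := fun k =>
    volume_ne_top_of_abs_le fun x hx i => abs_le_of_abs_floorFirst_le (hB _ hx i)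
  have hstep : ∀ k : Fin (n + 1),
      |volume.real (floorFirst (k : ℕ) ⁻¹' A) - volume.real (floorFirst ((k : ℕ) + 1) ⁻¹' A)| ≤
        m * (2 * (B + 1)) ^ n := by
    intro k
    refine (abs_measureReal_sub_le_measureReal_symmDiff'
      (measurable_floorFirst _ hA).nullMeasurableSet
      (measurable_floorFirst _ hA).nullMeasurableSet (hfin _) (hfin _)).trans ?_
    have h := ENNReal.toReal_mono (by finiteness) (volume_symmDiff_floorFirst_le hA hB hm k)
    rwa [ENNReal.toReal_mul, ENNReal.toReal_pow, ENNReal.toReal_ofReal (by linarith),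
      ENNReal.toReal_natCast] at h
  -- Telescoping from `k = 0`, where nothing is rounded, to `k = n + 1`, where the volume is the
  -- lattice point count.
  have hind : ∀ k ≤ n + 1, |volume.real (floorFirst k ⁻¹' A) - volume.real A| ≤
      k * (m * (2 * (B + 1)) ^ n) := by
    intro k
    induction k with
    | zero =>
      intro _
      have : (floorFirst 0 : (Fin (n + 1) → ℝ) → _) = id := by
        ext x i
        simp [floorFirst]
      simp [this]
    | succ k ih =>
      intro hk
      have h1 := hstep ⟨k, hk⟩
      have h2 := ih (by omega)
      rw [abs_sub_comm] at h1
      have h3 := abs_sub_le (volume.real (floorFirst (k + 1) ⁻¹' A))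
        (volume.real (floorFirst k ⁻¹' A)) (volume.real A)
      push_cast
      simp only at h1
      linarith
  have hlast : floorFirst (n + 1) ⁻¹' A = {x : Fin (n + 1) → ℝ | (fun i => (⌊x i⌋ : ℝ)) ∈ A} := by
    ext x
    have : floorFirst (n + 1) x = fun i => (⌊x i⌋ : ℝ) := by
      ext i
      rw [floorFirst, if_pos i.2]
    simp [this]
  rw [← volume_floor_preimage_eq_ncard hB, ← hlast]
  exact_mod_cast hind (n + 1) le_rfl

end PolySignature

/-! ### Scaling, integer polynomials and positivity. -/

namespace PolySignature

open Polynomial Filter Topology MeasureTheory Pointwise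

variable {d : ℕ}

theorem toPoly_smul (c : ℝ) (p : Fin (d + 1) → ℝ) : toPoly (c • p) = C c * toPoly p := by
  ext n
  rw [coeff_C_mul, coeff_toPoly, coeff_toPoly]
  split_ifs <;> simp

theorem nonrealCount_C_mul {c : ℝ} (hc : c ≠ 0) (P : ℝ[X]) :
    nonrealCount (C c * P) = nonrealCount P := by
  rw [nonrealCount, nonrealCount, aroots_C_mul _ hc]

theorem nonrealCount_mul {P Q : ℝ[X]} (hP : P ≠ 0) (hQ : Q ≠ 0) :
    nonrealCount (P * Q) = nonrealCount P + nonrealCount Q := by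
  rw [nonrealCount, aroots_mul (mul_ne_zero hP hQ), Multiset.countP_add]
  rfl

theorem nonrealCount_one : nonrealCount 1 = 0 := by
  simp [nonrealCount]

theorem nonrealCount_pow {P : ℝ[X]} (hP : P ≠ 0) (n : ℕ) :
    nonrealCount (P ^ n) = n * nonrealCount P := by
  induction n with
  | zero => simp [nonrealCount_one]
  | succ n ih => rw [pow_succ, nonrealCount_mul (pow_ne_zero _ hP) hP, ih, add_one_mul]

theorem nonrealCount_prod_X_sub_C {ι : Type*} (S : Finset ι) (f : ι → ℝ) :
    nonrealCount (∏ k ∈ S, (X - C (f k))) = 0 := by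
  classical
  induction S using Finset.induction_on with
  | empty => simp [nonrealCount_one]
  | insert a S ha ih =>
    rw [Finset.prod_insert ha, nonrealCount_mul (X_sub_C_ne_zero _)
      (Finset.prod_ne_zero_iff.2 fun k _ => X_sub_C_ne_zero _), ih, nonrealCount, aroots_X_sub_C]
    simp [Multiset.countP_eq_card_filter, Multiset.filter_singleton]

theorem nonrealCount_X_sq_add_one : nonrealCount (X ^ 2 + 1) = 2 := by
  have h : ((X ^ 2 + 1 : ℝ[X]).map (algebraMap ℝ ℂ)) =
      (X - C Complex.I) * (X - C (-Complex.I)) := by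
    have hI : (C Complex.I * C Complex.I : ℂ[X]) = -1 := by
      rw [← C_mul, Complex.I_mul_I, C_neg, C_1]
    rw [C_neg]
    simp only [Polynomial.map_add, Polynomial.map_pow, map_X, Polynomial.map_one]
    linear_combination hI
  rw [nonrealCount, aroots_def, h,
    roots_mul (mul_ne_zero (X_sub_C_ne_zero _) (X_sub_C_ne_zero _)), roots_X_sub_C, roots_X_sub_C]
  simp [Multiset.countP_eq_card_filter, Multiset.filter_singleton]

theorem mem_coeffSet_iff {s : ℕ} {B : ℝ} {p : Fin (d + 1) → ℝ} :
    p ∈ coeffSet d s B ↔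
      p (Fin.last d) ≠ 0 ∧ (∀ i, |p i| ≤ B) ∧ nonrealCount (toPoly p) = 2 * s :=
  Iff.rfl

theorem coeffSet_eq_smul (d s : ℕ) {B : ℝ} (hB : 0 < B) :
    coeffSet d s B = B • coeffSet d s 1 := by
  ext p
  rw [Set.mem_smul_set_iff_inv_smul_mem₀ hB.ne', mem_coeffSet_iff, mem_coeffSet_iff, toPoly_smul,
    nonrealCount_C_mul (inv_ne_zero hB.ne')]
  simp [abs_mul, abs_of_pos hB, hB.ne', inv_mul_le_iff₀ hB]

theorem volume_real_coeffSet (d s : ℕ) {B : ℝ} (hB : 0 < B) :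
    volume.real (coeffSet d s B) = volume.real (coeffSet d s 1) * B ^ (d + 1) := by
  rw [coeffSet_eq_smul d s hB, measureReal_def, Measure.addHaar_smul, ENNReal.toReal_mul,
    ENNReal.toReal_ofReal (abs_nonneg _), abs_of_pos (by positivity), Module.finrank_fin_fun,
    mul_comm, measureReal_def]

theorem intPolyCount_eq_ncard (d s : ℕ) (B : ℝ) :
    intPolyCount d s B =
      {z : Fin (d + 1) → ℤ | (fun i => (z i : ℝ)) ∈ coeffSet d s B}.ncard := by
  have hmap : ∀ f : ℤ[X], f.natDegree ≤ d → f.map (Int.castRingHom ℝ) =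
      toPoly (fun i : Fin (d + 1) => (f.coeff i : ℝ)) := by
    intro f hf
    rw [← toPoly_coeff (P := f.map (Int.castRingHom ℝ)) (d := d) (natDegree_map_le.trans hf)]
    simp
  have hbox : ∀ f : ℤ[X], (∀ i ≤ d, |(f.coeff i : ℝ)| ≤ B) ↔
      ∀ i : Fin (d + 1), |(f.coeff i : ℝ)| ≤ B := fun f =>
    ⟨fun h i => h i (Nat.le_of_lt_succ i.2), fun h i hi => h ⟨i, Nat.lt_succ_of_le hi⟩⟩
  have himage : (fun (f : ℤ[X]) (i : Fin (d + 1)) => f.coeff i) '' intPolySet d s B =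
      {z : Fin (d + 1) → ℤ | (fun i => (z i : ℝ)) ∈ coeffSet d s B} := by
    ext z
    constructor
    · rintro ⟨f, ⟨h1, h2, h3⟩, rfl⟩
      have hdeg := natDegree_eq_of_degree_eq_some h1
      refine mem_coeffSet_iff.2 ⟨?_, (hbox f).1 h2, ?_⟩
      · have := coeff_ne_zero_of_eq_degree h1
        simpa using this
      · rw [hmap f hdeg.le] at h3
        exact h3
    · intro hz
      obtain ⟨h1, h2, h3⟩ := mem_coeffSet_iff.1 (Set.mem_ofPred_eq.mp hz)
      have hcoeff : ∀ i : Fin (d + 1), (ofFn (d + 1) z).coeff i = z i := fun i =>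
        ofFn_coeff_eq_val_of_lt z i.2
      have hdeg : (ofFn (d + 1) z).natDegree ≤ d :=
        Nat.le_of_lt_succ (ofFn_natDegree_lt (by omega) z)
      refine ⟨ofFn (d + 1) z, ⟨?_, (hbox _).2 ?_, ?_⟩, funext hcoeff⟩
      · refine degree_eq_of_le_of_coeff_ne_zero (natDegree_le_iff_degree_le.1 hdeg) ?_
        have := hcoeff (Fin.last d)
        rw [Fin.val_last] at this
        rw [this]
        exact_mod_cast h1
      · simpa only [hcoeff] using h2
      · rw [hmap _ hdeg]
        simp only [hcoeff]
        exact h3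
  rw [intPolyCount, ← himage, Set.InjOn.ncard_image]
  intro f hf g hg hfg
  ext n
  by_cases hn : n ≤ d
  · exact congrFun hfg ⟨n, Nat.lt_succ_of_le hn⟩
  · have hf' := natDegree_eq_of_degree_eq_some hf.1
    have hg' := natDegree_eq_of_degree_eq_some hg.1
    rw [coeff_eq_zero_of_natDegree_lt (by omega), coeff_eq_zero_of_natDegree_lt (by omega)]

/-- Since `q 0 ≠ 0` is an open condition, `0` is not a root throughout a neighbourhood, so local
constancy holds without restriction to a subset. -/
theorem coeffSet_mem_nhds {s : ℕ} {q : Fin (d + 1) → ℝ} (hlast : q (Fin.last d) ≠ 0)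
    (h0 : q 0 ≠ 0) (hbox : ∀ i, |q i| < 1) (hcount : nonrealCount (toPoly q) = 2 * s)
    (hsimple : ∀ x : ℝ, (toPoly q).eval x = 0 → (toPoly q).derivative.eval x ≠ 0) :
    coeffSet d s 1 ∈ 𝓝 q := by
  have hmult : ∀ p : Fin (d + 1) → ℝ, p 0 ≠ 0 → (toPoly p).rootMultiplicity 0 = 0 := by
    intro p hp
    refine rootMultiplicity_eq_zero ?_
    rw [IsRoot, ← coeff_zero_eq_eval_zero]
    simpa using (coeff_toPoly_fin p 0).trans_ne hp
  have hS : IsOpen {p : Fin (d + 1) → ℝ | p 0 ≠ 0} :=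
    isOpen_ne_fun (continuous_apply 0) continuous_const
  have hev := eventually_nonrealCount_eq hlast (S := {p : Fin (d + 1) → ℝ | p 0 ≠ 0})
    (fun p hp => by rw [hmult p hp, hmult q h0]) fun x _ => hsimple x
  rw [hS.nhdsWithin_eq h0] at hev
  have hbox' : ∀ᶠ p in 𝓝 q, ∀ i, |p i| < 1 := eventually_all.2 fun i =>
    (continuous_apply i).abs.continuousAt.eventually_lt_const (hbox i)
  filter_upwards [hev, hbox',
    (continuous_apply (Fin.last d)).continuousAt.eventually_ne hlast] with p h1 h2 h3
  exact mem_coeffSet_iff.2 ⟨h3, fun i => (h2 i).le, h1.trans hcount⟩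

/-- A model polynomial with `s` conjugate pairs of roots `± i` and simple real roots `1, …, r`. -/
theorem exists_monic_nonrealCount_eq (s r : ℕ) :
    ∃ P : ℝ[X], P.Monic ∧ P.natDegree = 2 * s + r ∧ P.coeff 0 ≠ 0 ∧ nonrealCount P = 2 * s ∧
      ∀ x : ℝ, P.eval x = 0 → P.derivative.eval x ≠ 0 := by
  set g : ℝ[X] := (X ^ 2 + 1) ^ s with hg
  set h : ℝ[X] := ∏ k ∈ Finset.range r, (X - C ((k : ℝ) + 1)) with hh
  have hq : (X ^ 2 + 1 : ℝ[X]).Monic := by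
    simpa using monic_X_pow_add_C (1 : ℝ) two_ne_zero
  have hqd : (X ^ 2 + 1 : ℝ[X]).natDegree = 2 := by
    simpa using natDegree_X_pow_add_C (n := 2) (r := (1 : ℝ))
  have hgm : g.Monic := hq.pow s
  have hhm : h.Monic := monic_prod_of_monic _ _ fun k _ => monic_X_sub_C _
  have hgx : ∀ x : ℝ, g.eval x ≠ 0 := by
    intro x
    simp only [hg, eval_pow, eval_add, eval_X, eval_one]
    positivity
  refine ⟨g * h, hgm.mul hhm, ?_, ?_, ?_, ?_⟩
  · rw [hgm.natDegree_mul hhm, hq.natDegree_pow, hqd,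
      natDegree_prod_of_monic _ _ fun k _ => monic_X_sub_C _]
    simp only [natDegree_X_sub_C]
    simp [mul_comm]
  · rw [coeff_zero_eq_eval_zero, eval_mul, hh, eval_prod]
    refine mul_ne_zero (hgx 0) (Finset.prod_ne_zero_iff.2 fun k _ => ?_)
    simp only [eval_sub, eval_X, eval_C, zero_sub]
    exact neg_ne_zero.2 (by positivity)
  · rw [nonrealCount_mul hgm.ne_zero hhm.ne_zero, nonrealCount_pow hq.ne_zero,
      nonrealCount_X_sq_add_one, nonrealCount_prod_X_sub_C, add_zero, mul_comm]
  · intro x hx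
    rw [eval_mul] at hx
    have hhx := (mul_eq_zero.1 hx).resolve_left (hgx x)
    have hsep : h.Separable := by
      refine separable_prod_X_sub_C_iff'.2 fun a _ b _ hab => ?_
      simpa using hab
    rw [derivative_mul, eval_add, eval_mul, eval_mul, hhx, mul_zero, zero_add]
    refine mul_ne_zero (hgx x) ?_
    have := hsep.eval₂_derivative_ne_zero (RingHom.id ℝ) (x := x) (by simpa using hhx)
    simpa using this

theorem volume_coeffSet_pos {d s : ℕ} (hs : s ≤ d / 2) : 0 < volume (coeffSet d s 1) := by
  obtain ⟨P, hmonic, hdeg, h0, hcount, hsimple⟩ := exists_monic_nonrealCount_eq s (d - 2 * s)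
  replace hdeg : P.natDegree = d := by omega
  set p : Fin (d + 1) → ℝ := fun i => P.coeff i with hp
  have hpP : toPoly p = P := toPoly_coeff hdeg.le
  -- This scalar brings the model polynomial into the open unit box without changing its roots.
  have hc : (0 : ℝ) < (‖p‖ + 1)⁻¹ := by positivity
  have hlead : p (Fin.last d) = 1 := by
    rw [hp]
    simp only [Fin.val_last]
    rw [← hdeg]
    exact hmonic
  refine Measure.measure_pos_of_mem_nhds _ (x := (‖p‖ + 1)⁻¹ • p) (coeffSet_mem_nhds ?_ ?_ ?_ ?_ ?_)
  · simp only [Pi.smul_apply, hlead, smul_eq_mul, mul_one]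
    exact hc.ne'
  · exact mul_ne_zero hc.ne' h0
  · intro i
    rw [Pi.smul_apply, smul_eq_mul, abs_mul, abs_of_pos hc, inv_mul_lt_iff₀ (by positivity),
      mul_one]
    exact (norm_le_pi_norm p i).trans_lt (lt_add_one _)
  · rw [toPoly_smul, nonrealCount_C_mul hc.ne', hpP, hcount]
  · intro x hx
    rw [toPoly_smul, hpP] at hx ⊢
    rw [eval_mul, eval_C] at hx
    rw [derivative_C_mul, eval_mul, eval_C]
    exact mul_ne_zero hc.ne' (hsimple x ((mul_eq_zero.1 hx).resolve_left hc.ne'))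

theorem abs_intPolyCount_sub_le (d s : ℕ) {B : ℝ} (hB : 1 ≤ B) :
    |(intPolyCount d s B : ℝ) - volume.real (coeffSet d s 1) * B ^ (d + 1)| ≤
      ((d + 1) * ((d + 3) * 4 ^ d)) * B ^ d := by
  have h := abs_ncard_sub_volume_le (m := d + 3) (measurableSet_coeffSet d s B)
    (by linarith) (fun p hp => hp.2.1) (exists_finset_coeffSet_update s B)
  rw [← intPolyCount_eq_ncard, volume_real_coeffSet d s (by linarith)] at h
  refine h.trans ?_
  -- Here `1 ≤ B` enters, through `2 * (B + 1) ≤ 4 * B`.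
  have hpow : (2 * (B + 1)) ^ d ≤ 4 ^ d * B ^ d := by
    rw [← mul_pow]
    exact pow_le_pow_left₀ (by linarith) (by linarith) d
  push_cast
  calc ((d : ℝ) + 1) * ((d + 3) * (2 * (B + 1)) ^ d)
      ≤ (d + 1) * ((d + 3) * (4 ^ d * B ^ d)) := by gcongr
    _ = _ := by ring

end PolySignature

theorem theorem1 (d s : ℕ) (hd : 1 ≤ d) (hs : s ≤ d / 2) :
    MeasureTheory.NullMeasurableSet (PolySignature.coeffSet d s 1) MeasureTheory.volume ∧
    (∃ K : ℝ, ∀ B : ℝ, 1 ≤ B →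
      |(PolySignature.intPolyCount d s B : ℝ) -
        (MeasureTheory.volume (PolySignature.coeffSet d s 1)).toReal * B ^ (d + 1)|
        ≤ K * B ^ d) ∧
    0 < MeasureTheory.volume (PolySignature.coeffSet d s 1) :=
  ⟨(PolySignature.measurableSet_coeffSet d s 1).nullMeasurableSet,
    ⟨_, fun _ hB => PolySignature.abs_intPolyCount_sub_le d s hB⟩,
    PolySignature.volume_coeffSet_pos hs⟩
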